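/- Let $R=\mathbb F[x_1,\dots,x_n]$ be a polynomial ring over a field with an admissible term ordering $<$, where a *term* is a power product $x_1^{e_1}\cdots x_n^{e_n}$ (coefficient $1$) and a *monomial* is a nonzero scalar times a term. For nonzero $f\in R$ let $\operatorname{lt}(f)$ and $\operatorname{lc}(f)$ be its leading term and leading coefficient, and for nonzero $f,g$ put $$S(f,g)=\operatorname{lc}(g)\,\frac{\operatorname{lcm}(\operatorname{lt}(f),\operatorname{lt}(g))}{\operatorname{lt}(f)}\,f-\operatorname{lc}(f)\,\frac{\operatorname{lcm}(\operatorname{lt}(f),\operatorname{lt}(g))}{\operatorname{lt}(g)}\,g .$$ A tuple $G=(g_1,\dots,g_m)$ of nonzero polynomials is a *Gröbner basis* if for every nonzero $p$ in the ideal generated by $G$ some $\operatorname{lt}(g_i)$ divides $\operatorname{lt}(p)$. A polynomial $p$ *reduces to zero with respect to $G$* if $p=0$ or there are monomials $q_1,\dots,q_r$ and indices $\nu_1,\dots,\nu_r\in\{1,\dots,m\}$ with $p=q_1g_{\nu_1}+\cdots+q_rg_{\nu_r}$ such that, for each $k=1,\dots,r$, the term $\operatorname{lt}(q_k)\operatorname{lt}(g_{\nu_k})$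 occurs with nonzero coefficient in $p-q_1g_{\nu_1}-\cdots-q_{k-1}g_{\nu_{k-1}}$. Let $G=(g_1,\dots,g_m)$ be a *Pham-like system*: a tuple of nonzero polynomials for which there are terms $c_1,\dots,c_m,d$ such that $\operatorname{lt}(g_i)=c_id$ for all $i$, each $c_i$ is relatively prime to $d$, and $c_i,c_j$ are relatively prime whenever $i\ne j$. Fix such $c_1,\dots,c_m,d$. Then the following hold. 1. $G$ is a Gröbner basis if and only if the consecutive $S$-polynomials $S(g_1,g_2),S(g_2,g_3),\dots,S(g_{m-1},g_m)$ (of which there are $m-1$ if $m\ge1$, and none if $m=0$) all reduce to zero with respect to $G$. 2. If $d\neq1$, then no pair $(g_i,g_j)$ with $i\neq j$ satisfies Buchberger's gcd criterion, that is, $\operatorname{lt}(g_i)$ and $\operatorname{lt}(g_j)$ are not relatively prime. If $i,j,k$ are distinct and $c_k\neq1$, then $\operatorname{lt}(g_k)$ does not divide $\operatorname{lcm}(\operatorname{lt}(g_i),\operatorname{lt}(g_j))$, that is, Buchberger's lcm criterion does not apply. Consequently, if $d\ne1$ and $c_k\ne1$ for all $k$, then all $m(m-1)/2$ pairs $i<j$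 are left unresolved by Buchberger's two criteria. -/

import Mathlib

open MvPolynomial

/-- The terms (power products) `x₁^{e₁} ⋯ xₙ^{eₙ}` are encoded by their exponent vectors. Thus the
term `1` is `0`, the product of terms is `+`, divisibility is `≤`, gcd is `⊓` and lcm is `⊔`.
The leading term of a nonzero polynomial `f` is `ord.degree f`. -/
abbrev PolyTerm (n : ℕ) : Type := Fin n →₀ ℕ

/-- Two terms are relatively prime: their gcd is the term `1`. -/
def PolyTerm.RelPrime {n : ℕ} (s t : PolyTerm n) : Prop := s ⊓ t = 0

/-- `G = (g₁, …, g_m)` is a Gröbner basis: the leading term of every nonzero polynomial of the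
ideal generated by `G` is divisible by the leading term of some (nonzero) `gᵢ`. -/
def IsGroebnerBasis {n m : ℕ} {F : Type*} [Field F] (ord : MonomialOrder (Fin n))
    (G : Fin m → MvPolynomial (Fin n) F) : Prop :=
  ∀ p ∈ Ideal.span (Set.range G), p ≠ 0 →
    ∃ i, G i ≠ 0 ∧ ord.degree (G i) ≤ ord.degree p

/-- `p` reduces to zero with respect to `G`: `p = q₁ g_{ν₁} + ⋯ + q_r g_{ν_r}` (`r = 0` if `p = 0`)
with nonzero monomials `q_k` (a monomial is a scalar times a term) such that, for each `k`,
`lt(q_k) lt(g_{ν_k})` is a term occurring in `p - q₁ g_{ν₁} - ⋯ - q_{k-1} g_{ν_{k-1}}`.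
The `k`-th use of `step` supplies `q_k = a x^u` and `ν_k = i`. -/
inductive ReducesToZero {n m : ℕ} {F : Type*} [Field F] (ord : MonomialOrder (Fin n))
    (G : Fin m → MvPolynomial (Fin n) F) : MvPolynomial (Fin n) F → Prop
  | zero : ReducesToZero ord G 0
  | step (p : MvPolynomial (Fin n) F) (i : Fin m) (u : PolyTerm n) (a : F)
      (ha : a ≠ 0) (hi : G i ≠ 0) (hterm : u + ord.degree (G i) ∈ p.support)
      (hrest : ReducesToZero ord G (p - monomial u a * G i)) : ReducesToZero ord G p

/-- `G` is a Pham-like system with data `c₁, …, c_m, d`: the polynomials are nonzero, the leading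
term of `gᵢ` is `cᵢ d`, each `cᵢ` is relatively prime to `d`, and the `cᵢ` are pairwise relatively
prime. -/
structure IsPhamLike {n m : ℕ} {F : Type*} [Field F] (ord : MonomialOrder (Fin n))
    (G : Fin m → MvPolynomial (Fin n) F) (c : Fin m → PolyTerm n) (d : PolyTerm n) : Prop where
  ne_zero : ∀ i, G i ≠ 0
  leadingTerm_eq : ∀ i, ord.degree (G i) = c i + d
  relPrime_gcd : ∀ i, (c i).RelPrime d
  relPrime_pair : ∀ i j, i ≠ j → (c i).RelPrime (c j)

/-- Buchberger's gcd Criterion for `(t₁, t₂)`. -/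
def BuchbergerGcd {n : ℕ} (t₁ t₂ : PolyTerm n) : Prop := t₁.RelPrime t₂

/-- Buchberger's lcm Criterion for `(t₁, t₂, t₃)`: `t₂` divides `lcm(t₁, t₃)`. -/
def BuchbergerLcm {n : ℕ} (t₁ t₂ t₃ : PolyTerm n) : Prop := t₂ ≤ t₁ ⊔ t₃

/-- The pairs `i < j` to which neither of Buchberger's Criteria applies: the leading terms of `gᵢ`
and `gⱼ` are not relatively prime, and no third leading term divides their lcm. -/
def buchbergerUnresolved {n m : ℕ} {F : Type*} [Field F] (ord : MonomialOrder (Fin n))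
    (G : Fin m → MvPolynomial (Fin n) F) : Set (Fin m × Fin m) :=
  {p | p.1 < p.2 ∧ ¬ BuchbergerGcd (ord.degree (G p.1)) (ord.degree (G p.2)) ∧
    ∀ k, k ≠ p.1 → k ≠ p.2 →
      ¬ BuchbergerLcm (ord.degree (G p.1)) (ord.degree (G k)) (ord.degree (G p.2))}

/-- The pairs `(1,2), (2,3), …, (m-1,m)` (indices start at `0` in `Fin m`). -/
def consecutivePairs (m : ℕ) : Set (Fin m × Fin m) :=
  {p | (p.1 : ℕ) + 1 = (p.2 : ℕ)}

/-! If every ideal element has a divisible leading term, top reduction ends at zero, which is the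
easy direction. Conversely, let the generators be `g_0, …, g_k` with `k ≥ 1`. Each reduction of a
consecutive S-polynomial gives a syzygy whose correction terms lie strictly below the lcm. The `k`
syzygies form a `k × (k+1)` matrix, and by Cramer's rule `g_0` divides `Δ g_j` for all `j`, where
`Δ` is the minor omitting column `0`. A triangularity argument on leading terms gives `lt Δ = c_0 ⋯
c_{k-1}` (`IsPhamLike.exists_minor`).

Hence `g_0 ∣ Δ A` for some common divisor `A` of the `g_j`. Comparing exponents in `c_0 d ∣ c_0 ⋯
c_{k-1} lt A` and `lt A ∣ c_i d` forces `lt A = d`. So `g_i = A K_i` with `lt K_i = c_i` pairwise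
coprime; the `K_i` form a Gröbner basis, and multiplying by `A` preserves this. -/

namespace MonomialOrder

/-! ### Strict bounds on terms, determinants, and coprime leading terms. -/

variable {σ : Type*} {R : Type*} [CommRing R]

/-- Every term of `p` is strictly smaller than `D`; unlike a bound on `degree`, this holds for
`p = 0` whatever `D` is. -/
def SupportLT (ord : MonomialOrder σ) (p : MvPolynomial σ R) (D : σ →₀ ℕ) : Prop :=
  ∀ u ∈ p.support, ord.toSyn u < ord.toSyn D

variable {ord : MonomialOrder σ} {p q : MvPolynomial σ R} {D E : σ →₀ ℕ}

theorem supportLT_zero : ord.SupportLT (0 : MvPolynomial σ R) D := by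
  simp [SupportLT]

theorem SupportLT.add (hp : ord.SupportLT p D) (hq : ord.SupportLT q D) :
    ord.SupportLT (p + q) D := by
  classical
  intro u hu
  rcases Finset.mem_union.1 (support_add hu) with h | h
  exacts [hp u h, hq u h]

theorem SupportLT.neg (hp : ord.SupportLT p D) : ord.SupportLT (-p) D := by
  intro u hu
  exact hp u (by simpa using hu)

theorem SupportLT.sub (hp : ord.SupportLT p D) (hq : ord.SupportLT q D) :
    ord.SupportLT (p - q) D := by
  rw [sub_eq_add_neg]
  exact hp.add hq.neg

theorem SupportLT.sum {ι : Type*} {s : Finset ι} {f : ι → MvPolynomial σ R}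
    (h : ∀ i ∈ s, ord.SupportLT (f i) D) : ord.SupportLT (∑ i ∈ s, f i) D := by
  classical
  induction s using Finset.induction_on with
  | empty => simpa using supportLT_zero
  | insert a s ha ih =>
    rw [Finset.sum_insert ha]
    exact (h a (by simp)).add (ih fun i hi => h i (by simp [hi]))

theorem SupportLT.mul_of_degree_le (hp : ord.SupportLT p D)
    (hq : ord.toSyn (ord.degree q) ≤ ord.toSyn E) : ord.SupportLT (p * q) (D + E) := by
  classical
  intro u hu
  obtain ⟨a, ha, b, hb, rfl⟩ := Finset.mem_add.1 (support_mul p q hu)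
  rw [map_add, map_add]
  exact add_lt_add_of_lt_of_le (hp a ha) ((ord.le_degree hb).trans hq)

theorem SupportLT.coeff_eq_zero (hp : ord.SupportLT p D) : p.coeff D = 0 := by
  by_contra h
  exact lt_irrefl _ (hp D (mem_support_iff.2 h))

theorem SupportLT.degree_le (hp : ord.SupportLT p D) :
    ord.toSyn (ord.degree p) ≤ ord.toSyn D :=
  ord.degree_le_iff.2 fun u hu => (hp u hu).le

theorem supportLT_of_degree_lt (h : ord.toSyn (ord.degree p) < ord.toSyn D) :
    ord.SupportLT p D :=
  fun _ hu => (ord.le_degree hu).trans_lt h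

theorem supportLT_sPolynomial (f g : MvPolynomial σ R) :
    ord.SupportLT (ord.sPolynomial f g) (ord.degree f ⊔ ord.degree g) := by
  rcases ord.degree_sPolynomial f g with h | h
  · exact supportLT_of_degree_lt h
  · rw [h]; exact supportLT_zero

theorem add_ne_zero_and_degree_add (hp : p ≠ 0)
    (hq : ord.SupportLT q (ord.degree p)) :
    p + q ≠ 0 ∧ ord.degree (p + q) = ord.degree p := by
  have hc : (p + q).coeff (ord.degree p) ≠ 0 := by
    rw [coeff_add, hq.coeff_eq_zero, add_zero]
    exact ord.coeff_degree_ne_zero_iff.2 hp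
  refine ⟨fun h => hc (by simp [h]), ord.toSyn.injective (le_antisymm ?_ ?_)⟩
  · exact ord.degree_add_le.trans (sup_le le_rfl hq.degree_le)
  · exact ord.le_degree (mem_support_iff.2 hc)

theorem degree_le_of_dvd [NoZeroDivisors R] (h : p ∣ q) (hq : q ≠ 0) :
    ord.degree p ≤ ord.degree q := by
  obtain ⟨r, rfl⟩ := h
  rw [ord.degree_mul (left_ne_zero_of_mul hq) (right_ne_zero_of_mul hq)]
  exact le_self_add

/-- A square matrix whose entries above the diagonal are strictly below the row bound `r i`, and
whose diagonal entries attain that bound, has a determinant of degree `∑ i, r i`. -/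
theorem det_ne_zero_and_degree_det [IsDomain R] {k : ℕ}
    (N : Matrix (Fin k) (Fin k) (MvPolynomial σ R)) (r : Fin k → σ →₀ ℕ)
    (hdiag : ∀ i, N i i ≠ 0 ∧ ord.degree (N i i) = r i)
    (hle : ∀ i j, ord.toSyn (ord.degree (N i j)) ≤ ord.toSyn (r i))
    (hlt : ∀ i j, i < j → ord.SupportLT (N i j) (r i)) :
    N.det ≠ 0 ∧ ord.degree N.det = ∑ i, r i := by
  classical
  have hprod : ∀ τ : Equiv.Perm (Fin k), τ ≠ 1 →
      ord.SupportLT (∏ i, N (τ i) i) (∑ i, r i) := by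
    intro τ hτ
    -- A permutation with `i ≤ τ i` everywhere is the identity, because both sides have the same
    -- sum.
    obtain ⟨i, hi⟩ : ∃ i, τ i < i := by
      by_contra! h
      apply hτ
      have hsum : ∑ i, ((τ i : Fin k) : ℕ) = ∑ i : Fin k, (i : ℕ) :=
        Equiv.sum_comp τ (fun i : Fin k => (i : ℕ))
      have := (Finset.sum_eq_sum_iff_of_le (fun i _ => Fin.le_def.1 (h i))).1 hsum.symm
      ext i
      simpa using (this i (Finset.mem_univ i)).symm
    rw [← Finset.mul_prod_erase _ _ (Finset.mem_univ i), ← Equiv.sum_comp τ r,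
      ← Finset.add_sum_erase _ _ (Finset.mem_univ i)]
    refine (hlt _ _ hi).mul_of_degree_le (ord.degree_prod_le.trans ?_)
    rw [map_sum, map_sum]
    exact Finset.sum_le_sum fun j _ => hle _ _
  have hone : ord.degree (∏ i, N i i) = ∑ i, r i := by
    rw [ord.degree_prod fun i _ => (hdiag i).1]
    exact Finset.sum_congr rfl fun i _ => (hdiag i).2
  rw [Matrix.det_apply, ← Finset.add_sum_erase _ _ (Finset.mem_univ 1), ← hone]
  simp only [Equiv.Perm.sign_one, one_smul, Equiv.Perm.one_apply]
  refine add_ne_zero_and_degree_add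
    (Finset.prod_ne_zero_iff.2 fun i _ => (hdiag i).1) (SupportLT.sum fun τ hτ => ?_)
  rw [hone]
  have h := hprod τ (Finset.ne_of_mem_erase hτ)
  rcases Int.units_eq_one_or (Equiv.Perm.sign τ) with hs | hs <;> rw [hs]
  · simpa using h
  · simpa using h.neg

/-- Polynomials with pairwise relatively prime leading terms form a Gröbner basis. -/
theorem exists_degree_le_of_mem_span {F ι : Type*} [Field F] (k : ι → MvPolynomial σ F)
    (hk : ∀ i, k i ≠ 0) (hcop : ∀ i j, i ≠ j → ord.degree (k i) ⊓ ord.degree (k j) = 0)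
    (s : Finset ι) (p : MvPolynomial σ F) (hp : p ∈ Ideal.span (k '' s)) (hp0 : p ≠ 0) :
    ∃ i ∈ s, ord.degree (k i) ≤ ord.degree p := by
  classical
  induction s using Finset.induction_on generalizing p with
  | empty => simp at hp; exact absurd hp hp0
  | insert a s ha ih =>
    rw [Finset.coe_insert, Set.image_insert_eq, Ideal.mem_span_insert] at hp
    obtain ⟨h, p₀, hp₀, rfl⟩ := hp
    obtain ⟨g, r, hgr, -, hr⟩ := ord.div (b := fun i : s => k i)
      (fun i => (ord.leadingCoeff_ne_zero_iff.2 (hk i)).isUnit) h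
    -- Only the remainder `r` of `h` modulo the other generators stays as the coefficient of `k a`;
    -- the rest is absorbed into `q`.
    set q := p₀ + Finsupp.linearCombination _ (fun i : s => k i) g * k a with hq
    have hlin : Finsupp.linearCombination _ (fun i : s => k i) g ∈ Ideal.span (k '' s) := by
      rw [Finsupp.linearCombination_apply]
      exact Ideal.sum_mem _ fun i _ =>
        Ideal.mul_mem_left _ _ (Ideal.subset_span ⟨i, i.2, rfl⟩)
    have hqmem : q ∈ Ideal.span (k '' s) :=
      Ideal.add_mem _ hp₀ (Ideal.mul_mem_right _ _ hlin)
    have hpq : h * k a + p₀ = r * k a + q := by rw [hq, hgr]; ring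
    rw [hpq] at hp0 ⊢
    by_cases hq0 : q = 0
    · rw [hq0, add_zero] at hp0 ⊢
      exact ⟨a, by simp, degree_le_of_dvd (Dvd.intro_left _ rfl) hp0⟩
    obtain ⟨j, hj, hjq⟩ := ih q hqmem hq0
    by_cases hr0 : r = 0
    · exact ⟨j, by simp [hj], by simpa [hr0] using hjq⟩
    have hra : ord.degree (r * k a) = ord.degree r + ord.degree (k a) :=
      ord.degree_mul hr0 (hk a)
    -- No cancellation at the top: otherwise `lt (k j)` divides `lt r * lt (k a)`, hence `lt r` by
    -- coprimality, contradicting that `r` is reduced.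
    have hne : ord.degree (r * k a) ≠ ord.degree q := by
      intro he
      apply hr _ (ord.degree_mem_support hr0) ⟨j, hj⟩
      intro x
      have h1 := hjq x
      have h2 := DFunLike.congr_fun (hcop j a (by rintro rfl; exact ha hj)) x
      rw [← he, hra] at h1
      simp only [Finsupp.add_apply, Finsupp.inf_apply, Finsupp.coe_zero, Pi.zero_apply] at h1 h2
      change ord.degree (k j) x ≤ _
      rcases min_eq_iff.1 h2 with h2 | h2 <;> omega
    rcases lt_or_gt_of_ne (ord.toSyn.injective.ne hne) with hlt | hlt
    · exact ⟨j, by simp [hj], by rwa [degree_add_eq_right_of_lt hlt]⟩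
    · refine ⟨a, by simp, ?_⟩
      rw [degree_add_of_lt hlt, hra]
      exact le_add_self

end MonomialOrder


/-! ### Reduction to zero and Gröbner bases. -/

section Reduction

variable {n m : ℕ} {F : Type*} [Field F] {ord : MonomialOrder (Fin n)}
  {G : Fin m → MvPolynomial (Fin n) F}

/-- The leading term of each subtracted product occurs in the current polynomial, so it lies below
`D`, and the difference stays below `D`. -/
theorem ReducesToZero.exists_representation {p : MvPolynomial (Fin n) F} {D : Fin n →₀ ℕ}
    (h : ReducesToZero ord G p) (hp : ord.SupportLT p D) :
    ∃ q : Fin m → MvPolynomial (Fin n) F,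
      p = ∑ j, q j * G j ∧ ∀ j, ord.SupportLT (q j * G j) D := by
  classical
  induction h with
  | zero => exact ⟨0, by simp, fun j => by simpa using MonomialOrder.supportLT_zero⟩
  | step p i u a ha hi hterm _ ih =>
    have hmul : ord.SupportLT (monomial u a * G i) D := by
      refine MonomialOrder.supportLT_of_degree_lt (lt_of_le_of_lt ?_ (hp _ hterm))
      rw [ord.degree_mul (by simpa using ha) hi, ord.degree_monomial, if_neg ha]
    obtain ⟨q, hq, hqD⟩ := ih (hp.sub hmul)
    refine ⟨q + Pi.single i (monomial u a), ?_, fun j => ?_⟩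
    · simp only [Pi.add_apply, add_mul, Finset.sum_add_distrib, ← hq]
      rw [Finset.sum_eq_single i (fun j _ hj => by simp [hj]) (by simp)]
      simp
    · rw [Pi.add_apply, add_mul]
      refine (hqD j).add ?_
      by_cases hj : j = i
      · subst hj; simpa using hmul
      · simpa [hj] using MonomialOrder.supportLT_zero

theorem IsGroebnerBasis.reducesToZero (hG : IsGroebnerBasis ord G) (p : MvPolynomial (Fin n) F)
    (hp : p ∈ Ideal.span (Set.range G)) : ReducesToZero ord G p := by
  induction hD : ord.toSyn (ord.degree p) using WellFoundedLT.induction generalizing p with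
  | ind D ih =>
    subst hD
    by_cases hp0 : p = 0
    · rw [hp0]; exact .zero
    obtain ⟨i, hi, hdeg⟩ := hG p hp hp0
    have hu : IsUnit (ord.leadingCoeff (G i)) := (ord.leadingCoeff_ne_zero_iff.2 hi).isUnit
    have hmem : ord.reduce hu p ∈ Ideal.span (Set.range G) :=
      Ideal.sub_mem _ hp (Ideal.mul_mem_left _ _ (Ideal.subset_span ⟨i, rfl⟩))
    refine .step p i (ord.degree p - ord.degree (G i)) (hu.unit⁻¹ * ord.leadingCoeff p)
      (by simpa using ⟨hi, hp0⟩) hi ?_ ?_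
    · rw [tsub_add_cancel_of_le hdeg]
      exact ord.degree_mem_support hp0
    · change ReducesToZero ord G (ord.reduce hu p)
      -- For constant `p` the degree cannot drop; then `G i` is a nonzero constant too, and the
      -- reduction is exactly zero.
      by_cases h0 : ord.degree p = 0
      · have hz : ord.reduce hu p = 0 := by
          have hi0 : ord.degree (G i) = 0 := le_antisymm (h0 ▸ hdeg) bot_le
          rw [MonomialOrder.reduce, h0, hi0, tsub_zero, ← C_apply]
          have hGi : C (ord.leadingCoeff (G i)) = G i := (ord.eq_C_of_degree_eq_zero hi0).symm
          have hC : C (hu.unit⁻¹ * ord.leadingCoeff p) * C (ord.leadingCoeff (G i)) =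
              (C (ord.leadingCoeff p) : MvPolynomial (Fin n) F) := by
            rw [← C_mul, mul_right_comm, IsUnit.val_inv_mul, one_mul]
          rw [hGi, ← ord.eq_C_of_degree_eq_zero h0] at hC
          rw [hC, sub_self]
        rw [hz]; exact .zero
      · exact ih _ (ord.degree_reduce_lt hu hdeg h0) _ hmem rfl

theorem sPolynomial_mem_span (i j : Fin m) :
    ord.sPolynomial (G i) (G j) ∈ Ideal.span (Set.range G) :=
  Ideal.sub_mem _ (Ideal.mul_mem_left _ _ (Ideal.subset_span ⟨i, rfl⟩))
    (Ideal.mul_mem_left _ _ (Ideal.subset_span ⟨j, rfl⟩))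

theorem isGroebnerBasis_of_subsingleton (hm : m ≤ 1) : IsGroebnerBasis ord G := by
  have : Subsingleton (Fin m) := Fin.subsingleton_iff_le_one.2 hm
  intro p hp hp0
  rcases isEmpty_or_nonempty (Fin m) with he | ⟨⟨i⟩⟩
  · rw [Set.range_eq_empty, Ideal.span_empty] at hp
    exact absurd hp hp0
  · have : Unique (Fin m) := uniqueOfSubsingleton i
    rw [Set.range_unique, Ideal.mem_span_singleton] at hp
    exact ⟨default, fun h => hp0 (zero_dvd_iff.1 (h ▸ hp)),
      MonomialOrder.degree_le_of_dvd hp hp0⟩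

theorem isGroebnerBasis_mul_of_relPrime {A : MvPolynomial (Fin n) F} (hA : A ≠ 0)
    {k : Fin m → MvPolynomial (Fin n) F} (hk : ∀ i, k i ≠ 0)
    (hcop : ∀ i j, i ≠ j → ord.degree (k i) ⊓ ord.degree (k j) = 0) :
    IsGroebnerBasis ord (fun i => A * k i) := by
  intro p hp hp0
  obtain ⟨q, rfl⟩ : ∃ q : Fin m → MvPolynomial (Fin n) F, ∑ i, q i * (A * k i) = p :=
    (Ideal.mem_span_range_iff_exists_fun).1 hp
  have he : ∑ i, q i * (A * k i) = A * ∑ i, q i * k i := by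
    rw [Finset.mul_sum]
    exact Finset.sum_congr rfl fun i _ => by ring
  rw [he] at hp0 ⊢
  obtain ⟨i, -, hi⟩ := ord.exists_degree_le_of_mem_span k hk hcop Finset.univ (∑ i, q i * k i)
    (Ideal.sum_mem _ fun i _ => Ideal.mul_mem_left _ _ (Ideal.subset_span (by simp)))
    (right_ne_zero_of_mul hp0)
  refine ⟨i, mul_ne_zero hA (hk i), ?_⟩
  rw [ord.degree_mul hA (hk i), ord.degree_mul hA (right_ne_zero_of_mul hp0)]
  gcongr

end Reduction

/-! ### Divisibility: gcds and Cramer's rule. -/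

/-- A common multiplier of all `g j` into the multiples of `a` also multiplies some common
divisor of the `g j` into the multiples of `a`. -/
theorem exists_common_dvd_of_forall_dvd_mul {α ι : Type*} [CommRing α] [IsDomain α]
    [UniqueFactorizationMonoid α] [Fintype ι] {g : ι → α} {a b : α} (h : ∀ j, a ∣ b * g j) :
    ∃ e, (∀ j, e ∣ g j) ∧ a ∣ b * e := by
  let _ : StrongNormalizationMonoid α := UniqueFactorizationMonoid.strongNormalizationMonoid
  let _ : StrongNormalizedGCDMonoid α := UniqueFactorizationMonoid.toStrongNormalizedGCDMonoid α
  refine ⟨Finset.univ.gcd g, fun j => Finset.gcd_dvd (Finset.mem_univ j), ?_⟩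
  exact (Finset.dvd_gcd fun j _ => h j).trans (Finset.gcd_mul_left' _ _ b).dvd

/-- Cramer's rule: if `g` is annihilated by the rows of `M`, then `g 0` divides the product of
every `g j` with the minor of `M` omitting column `0`. -/
theorem dvd_det_submatrix_mul {α : Type*} [CommRing α] {k : ℕ}
    (M : Matrix (Fin k) (Fin (k + 1)) α) (g : Fin (k + 1) → α)
    (h : ∀ i, ∑ j, M i j * g j = 0) (j : Fin (k + 1)) :
    g 0 ∣ (M.submatrix id Fin.succ).det * g j := by
  refine Fin.cases (Dvd.intro_left _ rfl) (fun j => ?_) j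
  set M' := M.submatrix id Fin.succ with hM'
  -- Column `0` moves to the right-hand side; multiplying by the adjugate then isolates `det M' * g
  -- j.succ`.
  have hv : M'.mulVec (fun j => g j.succ) = g 0 • fun i => - M i 0 := by
    ext i
    have := h i
    rw [Fin.sum_univ_succ] at this
    simp only [Matrix.mulVec, dotProduct, hM', Matrix.submatrix_apply, id_eq, Pi.smul_apply,
      smul_eq_mul]
    linear_combination this
  have := congrArg (M'.adjugate.mulVec ·) hv
  simp only [Matrix.mulVec_mulVec, Matrix.adjugate_mul, Matrix.smul_mulVec, Matrix.one_mulVec,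
    Matrix.mulVec_smul] at this
  have hj := congrFun this j
  simp only [Pi.smul_apply, smul_eq_mul] at hj
  exact ⟨_, hj⟩

/-! ### Exponents of Pham-like systems and Buchberger's criteria. -/

namespace IsPhamLike

variable {n m : ℕ} {F : Type*} [Field F] {ord : MonomialOrder (Fin n)}
  {c : Fin m → PolyTerm n} {d : PolyTerm n}

theorem pair_eq_zero {G : Fin m → MvPolynomial (Fin n) F} (hG : IsPhamLike ord G c d)
    {i j : Fin m} (hij : i ≠ j) (x : Fin n) : c i x = 0 ∨ c j x = 0 := by
  have := DFunLike.congr_fun (hG.relPrime_pair i j hij) x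
  simp only [Finsupp.inf_apply, Finsupp.coe_zero, Pi.zero_apply] at this
  omega

theorem gcd_eq_zero {G : Fin m → MvPolynomial (Fin n) F} (hG : IsPhamLike ord G c d)
    (i : Fin m) (x : Fin n) : c i x = 0 ∨ d x = 0 := by
  have := DFunLike.congr_fun (hG.relPrime_gcd i) x
  simp only [Finsupp.inf_apply, Finsupp.coe_zero, Pi.zero_apply] at this
  omega

theorem sup_degree {G : Fin m → MvPolynomial (Fin n) F} (hG : IsPhamLike ord G c d)
    {i j : Fin m} (hij : i ≠ j) :
    ord.degree (G i) ⊔ ord.degree (G j) = c i + (c j + d) := by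
  rw [hG.leadingTerm_eq, hG.leadingTerm_eq]
  ext x
  have := hG.pair_eq_zero hij x
  simp only [Finsupp.sup_apply, Finsupp.add_apply]
  omega

theorem not_buchbergerGcd {G : Fin m → MvPolynomial (Fin n) F} (hG : IsPhamLike ord G c d)
    (hd : d ≠ 0) (i j : Fin m) :
    ¬ BuchbergerGcd (ord.degree (G i)) (ord.degree (G j)) := by
  intro h
  apply hd
  ext x
  have := DFunLike.congr_fun h x
  rw [hG.leadingTerm_eq, hG.leadingTerm_eq] at this
  simp only [Finsupp.inf_apply, Finsupp.add_apply, Finsupp.coe_zero, Pi.zero_apply] at this ⊢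
  omega

/-- At a variable of `c k` both `c i` and `c j` vanish, so the lcm has only the exponent of `d`
there. -/
theorem not_buchbergerLcm {G : Fin m → MvPolynomial (Fin n) F} (hG : IsPhamLike ord G c d)
    {i j k : Fin m} (hki : k ≠ i) (hkj : k ≠ j) (hk : c k ≠ 0) :
    ¬ BuchbergerLcm (ord.degree (G i)) (ord.degree (G k)) (ord.degree (G j)) := by
  intro h
  apply hk
  ext x
  have hx := h x
  rw [hG.leadingTerm_eq, hG.leadingTerm_eq, hG.leadingTerm_eq] at hx
  have h1 := hG.pair_eq_zero hki x
  have h2 := hG.pair_eq_zero hkj x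
  simp only [Finsupp.sup_apply, Finsupp.add_apply, Finsupp.coe_zero, Pi.zero_apply] at hx ⊢
  omega

theorem buchbergerUnresolved_eq {G : Fin m → MvPolynomial (Fin n) F}
    (hG : IsPhamLike ord G c d) (hd : d ≠ 0) (hc : ∀ k, c k ≠ 0) :
    buchbergerUnresolved ord G = {p | p.1 < p.2} := by
  ext p
  exact ⟨fun h => h.1, fun h => ⟨h, hG.not_buchbergerGcd hd _ _,
    fun k h1 h2 => hG.not_buchbergerLcm h1 h2 (hc k)⟩⟩

end IsPhamLike

/-! ### Counting pairs. -/

theorem ncard_lt_pairs (m : ℕ) :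
    {p : Fin m × Fin m | p.1 < p.2}.ncard = m * (m - 1) / 2 := by
  have h : {p : Fin m × Fin m | p.1 < p.2} =
      ((Finset.univ ×ˢ Finset.univ).filter fun p : Fin m × Fin m => p.1 < p.2) := by
    ext p; simp
  rw [h, Set.ncard_coe_finset, Finset.card_product_filter_lt, Finset.card_univ, Fintype.card_fin,
    Nat.choose_two_right]

theorem consecutivePairs_succ (k : ℕ) :
    consecutivePairs (k + 1) = Set.range fun i : Fin k => (i.castSucc, i.succ) := by
  ext ⟨a, b⟩
  simp only [consecutivePairs, Set.mem_ofPred_eq, Set.mem_range, Prod.mk.injEq]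
  constructor
  · intro h
    exact ⟨⟨a, by have := b.2; omega⟩, rfl, Fin.ext (by simpa using h)⟩
  · rintro ⟨i, rfl, rfl⟩
    simp

theorem ncard_consecutivePairs (m : ℕ) : (consecutivePairs m).ncard = m - 1 := by
  cases m with
  | zero => rw [Set.ncard_eq_zero, Set.eq_empty_of_isEmpty (consecutivePairs 0)]
  | succ k =>
    have hinj : Function.Injective fun i : Fin k => (i.castSucc, i.succ) := fun i j h =>
      Fin.succ_injective _ (Prod.ext_iff.1 h).2
    rw [consecutivePairs_succ, ← Set.image_univ, Set.ncard_image_of_injective _ hinj,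
      Set.ncard_univ, Nat.card_fin, Nat.add_sub_cancel]

/-! ### The determinantal argument and the main theorem. -/

theorem IsPhamLike.exists_minor {n k : ℕ} {F : Type*} [Field F] {ord : MonomialOrder (Fin n)}
    {G : Fin (k + 1) → MvPolynomial (Fin n) F} {c : Fin (k + 1) → PolyTerm n} {d : PolyTerm n}
    (hG : IsPhamLike ord G c d)
    (hS : ∀ i : Fin k, ReducesToZero ord G (ord.sPolynomial (G i.castSucc) (G i.succ))) :
    ∃ Δ : MvPolynomial (Fin n) F, Δ ≠ 0 ∧ ord.degree Δ = ∑ i : Fin k, c i.castSucc ∧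
      ∀ j, G 0 ∣ Δ * G j := by
  classical
  choose q hq hqlt using fun i : Fin k =>
    (hS i).exists_representation (MonomialOrder.supportLT_sPolynomial _ _)
  set r : Fin k → Fin n →₀ ℕ := fun i => ord.degree (G i.castSucc) ⊔ ord.degree (G i.succ) with hr
  set a : Fin k → MvPolynomial (Fin n) F := fun i =>
    monomial (r i - ord.degree (G i.castSucc)) (ord.leadingCoeff (G i.succ)) with ha
  set b : Fin k → MvPolynomial (Fin n) F := fun i =>
    monomial (r i - ord.degree (G i.succ)) (ord.leadingCoeff (G i.castSucc)) with hb
  have hS' : ∀ i, ord.sPolynomial (G i.castSucc) (G i.succ) =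
      a i * G i.castSucc - b i * G i.succ := fun i => ord.sPolynomial_def _ _
  have hadeg : ∀ i, ord.degree (a i * G i.castSucc) = r i := fun i => by
    have h0 : ord.leadingCoeff (G i.succ) ≠ 0 := ord.leadingCoeff_ne_zero_iff.2 (hG.ne_zero _)
    rw [ord.degree_mul (by simpa [ha] using hG.ne_zero _) (hG.ne_zero _), ha,
      ord.degree_monomial, if_neg h0, tsub_add_cancel_of_le le_sup_left]
  have hb0 : ∀ i, b i * G i.succ ≠ 0 := fun i =>
    mul_ne_zero (by simpa [hb] using hG.ne_zero _) (hG.ne_zero _)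
  have hbdeg : ∀ i, ord.degree (b i * G i.succ) = r i := fun i => by
    have h0 : ord.leadingCoeff (G i.castSucc) ≠ 0 := ord.leadingCoeff_ne_zero_iff.2 (hG.ne_zero _)
    rw [ord.degree_mul (left_ne_zero_of_mul (hb0 i)) (hG.ne_zero _), hb,
      ord.degree_monomial, if_neg h0, tsub_add_cancel_of_le le_sup_right]
  -- Row `i` is the syzygy obtained by subtracting the representation of the `i`-th S-polynomial
  -- from its definition.
  let M : Matrix (Fin k) (Fin (k + 1)) (MvPolynomial (Fin n) F) := fun i j =>
    (if j = i.castSucc then a i else 0) - (if j = i.succ then b i else 0) - q i j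
  have hMG : ∀ i, ∑ j, M i j * G j = 0 := by
    intro i
    simp only [M, sub_mul, Finset.sum_sub_distrib, ite_mul, zero_mul, Finset.sum_ite_eq',
      Finset.mem_univ, if_true]
    rw [← hS', ← hq, sub_self]
  -- Scaling column `j` by `G j.succ` bounds all of row `i` by the lcm `r i`. The `b i` entry is on
  -- the diagonal and attains the bound; the `a i` entry is below the diagonal or in the omitted
  -- column; the `q` terms are strictly smaller.
  let N : Matrix (Fin k) (Fin k) (MvPolynomial (Fin n) F) :=
    Matrix.of fun i j => G j.succ * M.submatrix id Fin.succ i j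
  have hN : ∀ i j, N i j = G j.succ * ((if j.succ = i.castSucc then a i else 0) -
      (if j.succ = i.succ then b i else 0) - q i j.succ) := fun _ _ => rfl
  have hNdiag : ∀ i, N i i = -(b i * G i.succ) + -(q i i.succ * G i.succ) := fun i => by
    have : i.succ ≠ i.castSucc := (Fin.castSucc_lt_succ).ne'
    rw [hN, if_neg this, if_pos rfl]
    ring
  have hNupper : ∀ i j, i < j → N i j = -(q i j.succ * G j.succ) := fun i j hij => by
    have h1 : j.succ ≠ i.castSucc := by
      intro h; have := congrArg Fin.val h; simp at this; omega
    have h2 : j.succ ≠ i.succ := fun h => hij.ne' (Fin.succ_injective _ h)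
    rw [hN, if_neg h1, if_neg h2]
    ring
  have hNlower : ∀ i j, j < i → ord.toSyn (ord.degree (N i j)) ≤ ord.toSyn (r i) := by
    intro i j hij
    have h2 : j.succ ≠ i.succ := fun h => hij.ne (Fin.succ_injective _ h)
    have : N i j = (if j.succ = i.castSucc then a i * G i.castSucc else 0) -
        q i j.succ * G j.succ := by
      rw [hN, if_neg h2]
      split_ifs with h
      · rw [h]; ring
      · ring
    rw [this]
    refine ord.degree_sub_le.trans (sup_le ?_ (hqlt i _).degree_le)
    split_ifs with h
    · rw [hadeg]
    · simp
  have hdiag : ∀ i, N i i ≠ 0 ∧ ord.degree (N i i) = r i := fun i => by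
    have h := MonomialOrder.add_ne_zero_and_degree_add (ord := ord)
      (p := -(b i * G i.succ)) (q := -(q i i.succ * G i.succ)) (neg_ne_zero.2 (hb0 i))
      (by rw [ord.degree_neg, hbdeg]; exact (hqlt i _).neg)
    rwa [← hNdiag, ord.degree_neg, hbdeg] at h
  have hupper : ∀ i j, i < j → ord.SupportLT (N i j) (r i) := fun i j hij => by
    rw [hNupper i j hij]; exact (hqlt i _).neg
  obtain ⟨hdet0, hdet⟩ := MonomialOrder.det_ne_zero_and_degree_det N r hdiag (fun i j => by
    rcases lt_trichotomy i j with h | rfl | h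
    · exact (hupper i j h).degree_le
    · rw [(hdiag i).2]
    · exact hNlower i j h) hupper
  have hNM : N.det = (∏ i : Fin k, G i.succ) * (M.submatrix id Fin.succ).det :=
    Matrix.det_mul_row _ _
  rw [hNM] at hdet0 hdet
  refine ⟨_, right_ne_zero_of_mul hdet0, ?_, dvd_det_submatrix_mul M G hMG⟩
  rw [ord.degree_mul (left_ne_zero_of_mul hdet0) (right_ne_zero_of_mul hdet0),
    ord.degree_prod fun i _ => hG.ne_zero _] at hdet
  -- Each lcm is `c i.castSucc` times `lt (G i.succ)`; the second factors are exactly those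
  -- introduced by the scaling, and cancel.
  have hsum : ∑ i, r i = ∑ i : Fin k, ord.degree (G i.succ) + ∑ i : Fin k, c i.castSucc := by
    rw [← Finset.sum_add_distrib]
    refine Finset.sum_congr rfl fun i _ => ?_
    rw [hG.leadingTerm_eq i.succ, add_comm _ (c i.castSucc)]
    exact hG.sup_degree (Fin.castSucc_lt_succ).ne
  rw [hsum] at hdet
  exact add_left_cancel hdet

theorem IsPhamLike.isGroebnerBasis_of_reducesToZero {n k : ℕ} {F : Type*} [Field F]
    {ord : MonomialOrder (Fin n)} {G : Fin (k + 2) → MvPolynomial (Fin n) F}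
    {c : Fin (k + 2) → PolyTerm n} {d : PolyTerm n} (hG : IsPhamLike ord G c d)
    (hS : ∀ i : Fin (k + 1),
      ReducesToZero ord G (ord.sPolynomial (G i.castSucc) (G i.succ))) :
    IsGroebnerBasis ord G := by
  obtain ⟨Δ, hΔ0, hΔ, hdvd⟩ := hG.exists_minor hS
  obtain ⟨A, hA, hA'⟩ := exists_common_dvd_of_forall_dvd_mul hdvd
  have hA0 : A ≠ 0 := fun h => hG.ne_zero 0 (zero_dvd_iff.1 (h ▸ hA 0))
  have hAle : ∀ i, ord.degree A ≤ c i + d := fun i =>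
    hG.leadingTerm_eq i ▸ MonomialOrder.degree_le_of_dvd (hA i) (hG.ne_zero i)
  have hAdeg : ord.degree A = d := by
    have hge := MonomialOrder.degree_le_of_dvd (ord := ord) hA' (mul_ne_zero hΔ0 hA0)
    rw [ord.degree_mul hΔ0 hA0, hΔ, hG.leadingTerm_eq] at hge
    ext x
    have h0 := hAle 0 x
    have h1 := hAle 1 x
    have hp := hG.pair_eq_zero (i := 0) (j := 1) (by simp) x
    have hx := hge x
    simp only [Finsupp.add_apply, Finsupp.finsetSum_apply] at h0 h1 hx
    -- Off `d`, coprimality of `c 0` and `c 1` forces exponent `0` in `A`; this needs two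
    -- generators. On `d`, all `c i` vanish and the two divisibilities give equality.
    by_cases hdx : d x = 0
    · omega
    · have hc : ∀ i, c i x = 0 := fun i => (hG.gcd_eq_zero i x).resolve_right hdx
      simp only [hc, Finset.sum_const_zero] at hx h0
      omega
  choose K hK using hA
  have hK0 : ∀ i, K i ≠ 0 := fun i h => hG.ne_zero i (by rw [hK, h, mul_zero])
  have hKdeg : ∀ i, ord.degree (K i) = c i := fun i => by
    have h := hG.leadingTerm_eq i
    rw [hK, ord.degree_mul hA0 (hK0 i), hAdeg, add_comm] at h
    exact add_right_cancel h
  rw [funext hK]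
  refine isGroebnerBasis_mul_of_relPrime hA0 hK0 fun i j hij => ?_
  rw [hKdeg, hKdeg]
  exact hG.relPrime_pair i j hij

theorem mainTheorem2 {n m : ℕ} {F : Type*} [Field F] (ord : MonomialOrder (Fin n))
    (G : Fin m → MvPolynomial (Fin n) F) (c : Fin m → PolyTerm n) (d : PolyTerm n)
    (hG : IsPhamLike ord G c d) :
    (IsGroebnerBasis ord G ↔
      ∀ p ∈ consecutivePairs m, ReducesToZero ord G (ord.sPolynomial (G p.1) (G p.2))) ∧
    (consecutivePairs m).ncard = m - 1 ∧
    (d ≠ 0 → ∀ i j, i ≠ j → ¬ BuchbergerGcd (ord.degree (G i)) (ord.degree (G j))) ∧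
    (∀ i j k, i ≠ j → k ≠ i → k ≠ j → c k ≠ 0 →
      ¬ BuchbergerLcm (ord.degree (G i)) (ord.degree (G k)) (ord.degree (G j))) ∧
    (d ≠ 0 → (∀ k, c k ≠ 0) → (buchbergerUnresolved ord G).ncard = m * (m - 1) / 2) := by
  refine ⟨⟨fun h p _ => h.reducesToZero _ (sPolynomial_mem_span _ _), fun h => ?_⟩,
    ncard_consecutivePairs m, fun hd i j _ => hG.not_buchbergerGcd hd i j,
    fun i j k _ hki hkj hk => hG.not_buchbergerLcm hki hkj hk, fun hd hc => ?_⟩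
  -- With at most one generator the ideal is zero or principal, and no S-polynomials are needed.
  · match m, G, c, hG, h with
    | 0, _, _, _, _ => exact isGroebnerBasis_of_subsingleton (by omega)
    | 1, _, _, _, _ => exact isGroebnerBasis_of_subsingleton le_rfl
    | k + 2, G, c, hG, h =>
      exact hG.isGroebnerBasis_of_reducesToZero fun i =>
        h (i.castSucc, i.succ) (by simp [consecutivePairs])
  · rw [hG.buchbergerUnresolved_eq hd hc, ncard_lt_pairs]
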